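/- **Theorem 3.3 (Burkholder–Davis–Gundy inequality in amalgam spaces).** For $n\in\mathbb{N}=\{0,1,2,\dots\}$ let $\mathcal{F}_n$ be the $\sigma$-algebra on $\mathbb{R}$ generated by the dyadic intervals $[k2^{-n},(k+1)2^{-n})$, $k\in\mathbb{Z}$, and let $\mathbb{P}$ be a probability measure on the $\sigma$-algebra $\mathcal{F}$ generated by $\bigcup_n\mathcal{F}_n$ (the Borel $\sigma$-algebra). Let $\mathcal{M}$ be the set of all real martingales $f=(f_n)_{n\ge 0}$ with respect to $(\mathcal{F}_n)_{n\ge0}$ and $\mathbb{P}$ with $f_0=0$ almost surely. Put $d_0f=0$, $d_nf=f_n-f_{n-1}$ for $n\ge1$, and $$S(f)=\Big(\sum_{n\ge0}|d_nf|^2\Big)^{1/2},\qquad f^*=\sup_{n\ge0}|f_n| .$$ For $0<p<\infty$ and a measurable $g:\mathbb{R}\to[0,\infty]$ put $$\|g\|_{L_{p,q}}=\Big(\sum_{j\in\mathbb{Z}}\Big(\int_{[j,j+1)}g^p\,d\mathbb{P}\Big)^{q/p}\Big)^{1/q}\ (0<q<\infty),\qquad \|g\|_{L_{p,\infty}}=\sup_{j\in\mathbb{Z}}\Big(\int_{[j,j+1)}g^p\,d\mathbb{P}\Big)^{1/p},$$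 with values in $[0,\infty]$. Let $H^S_{p,q}$ (respectively $H^*_{p,q}$) be the space of all $f\in\mathcal{M}$ with $\|f\|_{H^S_{p,q}}:=\|S(f)\|_{L_{p,q}}<\infty$ (respectively $\|f\|_{H^*_{p,q}}:=\|f^*\|_{L_{p,q}}<\infty$). Then for every $1\le p<\infty$ there are constants $0<c_p,C_p<\infty$, depending only on $p$, such that for every probability measure $\mathbb{P}$ as above and every $1\le q\le\infty$ the spaces $H^S_{p,q}$ and $H^*_{p,q}$ coincide, and for every $f\in\mathcal{M}$ $$c_p\,\|S(f)\|_{L_{p,q}}\le\|f^*\|_{L_{p,q}}\le C_p\,\|S(f)\|_{L_{p,q}} .$$ -/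

import Mathlib

open MeasureTheory Set
open scoped ENNReal NNReal

noncomputable section

namespace DyadicAmalgam

/-- The dyadic interval `[k / 2^n, (k + 1) / 2^n)`. -/
def dyadicInterval (n : ℕ) (k : ℤ) : Set ℝ :=
  Ico ((k : ℝ) / 2 ^ n) (((k : ℝ) + 1) / 2 ^ n)

/-- The sigma-algebra on `ℝ` generated by the dyadic intervals of length `2^(-n)`. -/
def dyadicSigma (n : ℕ) : MeasurableSpace ℝ :=
  MeasurableSpace.generateFrom (range (dyadicInterval n))

lemma dyadicInterval_succ (n : ℕ) (k : ℤ) :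
    dyadicInterval n k = dyadicInterval (n + 1) (2 * k) ∪ dyadicInterval (n + 1) (2 * k + 1) := by
  have h2 : (0 : ℝ) < 2 ^ n := by positivity
  have e1 : ((2 * k : ℤ) : ℝ) / 2 ^ (n + 1) = (k : ℝ) / 2 ^ n := by
    push_cast; field_simp; ring
  have e2 : (((2 * k + 1 : ℤ) : ℝ) + 1) / 2 ^ (n + 1) = ((k : ℝ) + 1) / 2 ^ n := by
    push_cast; field_simp; ring
  have e3 : (((2 * k : ℤ) : ℝ) + 1) / 2 ^ (n + 1) = ((2 * k + 1 : ℤ) : ℝ) / 2 ^ (n + 1) := by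
    push_cast; ring
  unfold dyadicInterval
  rw [e3, Ico_union_Ico_eq_Ico, e1, e2]
  · gcongr; norm_cast; omega
  · gcongr; linarith

lemma dyadicSigma_le_succ (n : ℕ) : dyadicSigma n ≤ dyadicSigma (n + 1) := by
  refine MeasurableSpace.generateFrom_le ?_
  rintro _ ⟨k, rfl⟩
  rw [dyadicInterval_succ]
  exact MeasurableSet.union (MeasurableSpace.measurableSet_generateFrom ⟨_, rfl⟩)
    (MeasurableSpace.measurableSet_generateFrom ⟨_, rfl⟩)

lemma dyadicSigma_le_borel (n : ℕ) : dyadicSigma n ≤ Real.measurableSpace := by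
  refine MeasurableSpace.generateFrom_le ?_
  rintro _ ⟨k, rfl⟩
  exact measurableSet_Ico

/-- The dyadic filtration of `ℝ`, indexed by `n = 0, 1, 2, …`. -/
def dyadicFiltration : Filtration ℕ Real.measurableSpace where
  seq := dyadicSigma
  mono' := monotone_nat_of_le_succ dyadicSigma_le_succ
  le' := dyadicSigma_le_borel

/-- The sigma-algebra generated by the union of the dyadic sigma-algebras, on which the
probability measure lives, is the Borel sigma-algebra. -/
lemma iSup_dyadicSigma : ⨆ n, dyadicSigma n = Real.measurableSpace := by
  refine le_antisymm (iSup_le dyadicSigma_le_borel) ?_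
  rw [BorelSpace.measurable_eq (α := ℝ), borel_eq_generateFrom_Iio]
  refine MeasurableSpace.generateFrom_le ?_
  rintro _ ⟨a, rfl⟩
  have h : Iio a = ⋃ (n : ℕ) (k : ℤ) (_ : ((k : ℝ) + 1) / 2 ^ n ≤ a), dyadicInterval n k := by
    ext x
    simp only [mem_Iio, mem_iUnion, exists_prop]
    constructor
    · intro hx
      obtain ⟨n, hn⟩ := exists_pow_lt_of_lt_one (sub_pos.2 hx) (by norm_num : (1 / 2 : ℝ) < 1)
      have h2 : (0 : ℝ) < 2 ^ n := by positivity
      rw [one_div, inv_pow, inv_lt_iff_one_lt_mul₀ h2] at hn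
      have f1 := Int.floor_le (x * 2 ^ n)
      have f2 := Int.lt_floor_add_one (x * 2 ^ n)
      refine ⟨n, ⌊x * 2 ^ n⌋, ?_, ?_, ?_⟩
      · rw [div_le_iff₀ h2]; nlinarith
      · rwa [div_le_iff₀ h2]
      · rwa [lt_div_iff₀ h2]
    · rintro ⟨n, k, hk, hx⟩
      exact hx.2.trans_le hk
  rw [h]
  refine MeasurableSet.iUnion fun n => MeasurableSet.iUnion fun k => MeasurableSet.iUnion fun _ => ?_
  exact (le_iSup dyadicSigma n) _ (MeasurableSpace.measurableSet_generateFrom ⟨k, rfl⟩)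

/-- The quasi-norm of the amalgam space of `L_p` and `ℓ_q` over the unit intervals `[j, j + 1)`,
for `0 < p < ∞` and `0 < q ≤ ∞`, of a nonnegative (possibly infinite-valued) function `g`. -/
def amalgamNorm (P : Measure ℝ) (p : ℝ) (q : ℝ≥0∞) (g : ℝ → ℝ≥0∞) : ℝ≥0∞ :=
  if q = ∞ then
    ⨆ j : ℤ, (∫⁻ x in Ico (j : ℝ) ((j : ℝ) + 1), g x ^ p ∂P) ^ (1 / p)
  else
    (∑' j : ℤ, (∫⁻ x in Ico (j : ℝ) ((j : ℝ) + 1), g x ^ p ∂P) ^ (q.toReal / p)) ^ (1 / q.toReal)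

/-- The dyadic martingales of `(ℝ, P)` that start at `0`. -/
def dyadicMartingales (P : Measure ℝ) : Set (ℕ → ℝ → ℝ) :=
  {f | Martingale f dyadicFiltration P ∧ f 0 =ᵐ[P] 0}

/-- The martingale differences `d_0 f = 0` and `d_n f = f_n - f_{n-1}` for `n ≥ 1`. -/
def mdiff (f : ℕ → ℝ → ℝ) : ℕ → ℝ → ℝ
  | 0 => 0
  | n + 1 => f (n + 1) - f n

/-- The quadratic variation `S(f)`. -/
def quadVar (f : ℕ → ℝ → ℝ) (x : ℝ) : ℝ≥0∞ :=
  (∑' n : ℕ, ‖mdiff f n x‖ₑ ^ 2) ^ (1 / 2 : ℝ)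

/-- The maximal function `f^*`. -/
def maximalFn (f : ℕ → ℝ → ℝ) (x : ℝ) : ℝ≥0∞ :=
  ⨆ n : ℕ, ‖f n x‖ₑ

/-- The quasi-norm of the Hardy-amalgam space defined by the quadratic variation. -/
def normHS (P : Measure ℝ) (p : ℝ) (q : ℝ≥0∞) (f : ℕ → ℝ → ℝ) : ℝ≥0∞ :=
  amalgamNorm P p q (quadVar f)

/-- The quasi-norm of the Hardy-amalgam space defined by the maximal function. -/
def normHstar (P : Measure ℝ) (p : ℝ) (q : ℝ≥0∞) (f : ℕ → ℝ → ℝ) : ℝ≥0∞ :=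
  amalgamNorm P p q (maximalFn f)

/-- The martingale Hardy-amalgam space `H^S_{p,q}(ℝ)`. -/
def hardyS (P : Measure ℝ) (p : ℝ) (q : ℝ≥0∞) : Set (ℕ → ℝ → ℝ) :=
  {f | f ∈ dyadicMartingales P ∧ normHS P p q f < ∞}

/-- The martingale Hardy-amalgam space `H^*_{p,q}(ℝ)`. -/
def hardyStar (P : Measure ℝ) (p : ℝ) (q : ℝ≥0∞) : Set (ℕ → ℝ → ℝ) :=
  {f | f ∈ dyadicMartingales P ∧ normHstar P p q f < ∞}

end DyadicAmalgam

end

/-! Each unit interval `[j, j + 1)` lies in the initial sigma-algebra, so cutting `f - f 0` down to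
it leaves a martingale, and the amalgam norms only assemble the local `L_p` norms. An `L_p`
inequality on each interval, with a constant independent of `j`, therefore gives the theorem for
every `q` at once. On a unit interval `f n` takes finitely many values, so every local martingale is
bounded at each fixed time and all integrability questions vanish.

The local inequality combines two ingredients. The first is deterministic: for any real sequence
starting at 0, the square function and the maximal function dominate each other up to a discrete
stochastic integral with bounded integrand (`sqrt_pathSq_le`, `pathMax_le_sqrt`). These come from
potentials that decrease along the path up to a martingale increment. The second is Garsia's lemma
(`integral_rpow_le_of_tail_le`), which turns weighted estimates of the tails `A N - A l` into an
`L_p` bound. The tail estimates follow by applying the pathwise inequalities to the path restarted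
at time `l`: the stochastic integral disappears in expectation. Monotone convergence then removes
the finite horizon. -/

namespace DyadicAmalgam

/-! ### Square function and running maximum of a real sequence -/

/-- The sum of the squared increments of a sequence up to time `n`. -/
def pathSq (x : ℕ → ℝ) (n : ℕ) : ℝ := ∑ i ∈ Finset.range n, (x (i + 1) - x i) ^ 2

/-- The running maximum of the absolute values of a sequence. -/
def pathMax (x : ℕ → ℝ) (n : ℕ) : ℝ := partialSups (fun i => |x i|) n

lemma pathSq_zero (x : ℕ → ℝ) : pathSq x 0 = 0 := by simp [pathSq]

lemma pathSq_succ (x : ℕ → ℝ) (n : ℕ) :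
    pathSq x (n + 1) = pathSq x n + (x (n + 1) - x n) ^ 2 := Finset.sum_range_succ _ _

lemma pathSq_nonneg (x : ℕ → ℝ) (n : ℕ) : 0 ≤ pathSq x n :=
  Finset.sum_nonneg fun _ _ => sq_nonneg _

lemma pathSq_mono (x : ℕ → ℝ) : Monotone (pathSq x) :=
  monotone_nat_of_le_succ fun n => by rw [pathSq_succ]; nlinarith [sq_nonneg (x (n + 1) - x n)]

lemma pathSq_shift (x : ℕ → ℝ) (l n : ℕ) :
    pathSq (fun i => x (l + i) - x l) n = pathSq x (l + n) - pathSq x l := by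
  induction n with
  | zero => simp [pathSq_zero]
  | succ n ih => rw [pathSq_succ, ih, ← add_assoc, pathSq_succ]; ring

lemma pathMax_zero (x : ℕ → ℝ) : pathMax x 0 = |x 0| := by simp [pathMax]

lemma pathMax_succ (x : ℕ → ℝ) (n : ℕ) :
    pathMax x (n + 1) = max (pathMax x n) |x (n + 1)| := by
  simp only [pathMax, partialSups_add_one]

lemma abs_le_pathMax (x : ℕ → ℝ) {i n : ℕ} (h : i ≤ n) : |x i| ≤ pathMax x n :=
  le_partialSups_of_le (fun i => |x i|) h

lemma pathMax_le {x : ℕ → ℝ} {n : ℕ} {a : ℝ} (h : ∀ i ≤ n, |x i| ≤ a) : pathMax x n ≤ a :=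
  partialSups_le _ _ _ h

lemma pathMax_nonneg (x : ℕ → ℝ) (n : ℕ) : 0 ≤ pathMax x n :=
  (abs_nonneg _).trans (abs_le_pathMax x le_rfl)

lemma pathMax_mono (x : ℕ → ℝ) : Monotone (pathMax x) := (partialSups _).monotone

lemma pathSq_eq_zero_of_pathMax {x : ℕ → ℝ} {n : ℕ} (h : pathMax x n = 0) : pathSq x n = 0 := by
  have hx : ∀ i ≤ n, x i = 0 := fun i hi => by
    simpa using (abs_le_pathMax x hi).trans h.le
  refine Finset.sum_eq_zero fun i hi => ?_
  have := Finset.mem_range.1 hi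
  rw [hx i (by omega), hx (i + 1) (by omega)]; simp

lemma pathMax_shift_le (x : ℕ → ℝ) (l n : ℕ) :
    pathMax (fun i => x (l + i) - x l) n ≤ 2 * pathMax x (l + n) :=
  pathMax_le fun i hi => by
    have h1 := abs_le_pathMax x (show l + i ≤ l + n by omega)
    have h2 := abs_le_pathMax x (show l ≤ l + n by omega)
    have h3 := abs_sub (x (l + i)) (x l)
    linarith

lemma pathMax_sub_le (x : ℕ → ℝ) (l n : ℕ) :
    pathMax x (l + n) - pathMax x l ≤ pathMax (fun i => x (l + i) - x l) n := by
  rw [sub_le_iff_le_add]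
  refine pathMax_le fun i hi => ?_
  rcases le_total i l with h | h
  · exact (abs_le_pathMax x h).trans (le_add_of_nonneg_left (pathMax_nonneg _ _))
  · obtain ⟨k, rfl⟩ := Nat.exists_eq_add_of_le h
    have h1 := abs_le_pathMax (fun i => x (l + i) - x l) (show k ≤ n by omega)
    have h2 := abs_le_pathMax x (le_refl l)
    have h3 := abs_add_le (x (l + k) - x l) (x l)
    rw [sub_add_cancel] at h3
    linarith

lemma sqrt_pathSq_sub_le (x : ℕ → ℝ) (l n : ℕ) :
    √(pathSq x (l + n)) - √(pathSq x l) ≤ √(pathSq (fun i => x (l + i) - x l) n) := by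
  rw [pathSq_shift, sub_le_iff_le_add]
  have h := pathSq_mono x (show l ≤ l + n by omega)
  refine Real.sqrt_le_iff.2 ⟨by positivity, ?_⟩
  have h1 := Real.sq_sqrt (sub_nonneg.2 h)
  have h2 := Real.sq_sqrt (pathSq_nonneg x l)
  nlinarith [mul_nonneg (Real.sqrt_nonneg (pathSq x (l + n) - pathSq x l))
    (Real.sqrt_nonneg (pathSq x l))]

/-! ### Potentials and the pathwise Davis inequalities -/

/-- With the denominator frozen at `m` the step is an exact identity. Raising the maximum from `m`
to `M` costs nothing: `M - m ≤ |d|` gives `t + d ^ 2 - M ^ 2 + 2 * m * M ≥ t + m ^ 2 ≥ 0`. -/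
lemma sq_max_potential_step {x d t m : ℝ} (hx : |x| ≤ m) (ht : 0 ≤ t) (h0 : m = 0 → t = 0) :
    (t + d ^ 2 - (x + d) ^ 2) / max m |x + d| - 2 * max m |x + d|
      ≤ (t - x ^ 2) / m - 2 * m - 2 * (x / m * d) := by
  -- While the path has stayed at 0, division by zero returns 0 and the claim reduces to `-2 * |d| ≤
  -- 0`.
  rcases (abs_nonneg x |>.trans hx).eq_or_lt with hm | hm
  · have ht0 := h0 hm.symm
    have hx0 : x = 0 := by simpa [← hm] using hx
    subst hx0 ht0 hm
    simp
  have e : (t - x ^ 2) / m - 2 * m - 2 * (x / m * d) = (t + d ^ 2 - (x + d) ^ 2) / m - 2 * m := by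
    field_simp; ring
  rw [e]
  rcases le_total |x + d| m with h | h
  · rw [max_eq_left h]
  rw [max_eq_right h, ← sq_abs (x + d)]
  have hd : |x + d| - m ≤ |d| := by have := abs_add_le x d; linarith
  generalize |x + d| = M at *
  have hM : 0 < M := hm.trans_le h
  have hd2 : (M - m) ^ 2 ≤ d ^ 2 := by
    rw [← sq_abs d]; exact pow_le_pow_left₀ (by linarith) hd 2
  have e2 : (t + d ^ 2 - M ^ 2) / m - 2 * m - ((t + d ^ 2 - M ^ 2) / M - 2 * M)
      = (M - m) / (m * M) * (t + d ^ 2 - M ^ 2 + 2 * m * M) := by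
    field_simp; ring
  have : 0 ≤ (M - m) / (m * M) * (t + d ^ 2 - M ^ 2 + 2 * m * M) :=
    mul_nonneg (div_nonneg (by linarith) (by positivity)) (by nlinarith)
  linarith

/-- The term `-20 * s` pays for everything. The constant is chosen for comfort and is not optimal.
-/
lemma max_sq_potential_step {x d s s' m : ℝ} (hx : |x| ≤ m) (hs : 0 ≤ s) (hs' : 0 ≤ s')
    (h : s' ^ 2 = s ^ 2 + d ^ 2) :
    ((x + d) ^ 2 + s' ^ 2) / (max m |x + d| + s') + max m |x + d| / 2 - 20 * s'
      ≤ (x ^ 2 + s ^ 2) / (m + s) + m / 2 - 20 * s + 2 * (x / (m + s) * d) := by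
  have hm : 0 ≤ m := (abs_nonneg x).trans hx
  have hd := abs_nonneg d
  have hd2 := sq_abs d
  have hm' : max m |x + d| ≤ m + |d| := by
    refine max_le (by linarith) ?_
    have := abs_add_le x d; linarith
  have hmm : m ≤ max m |x + d| := le_max_left _ _
  have hxm : |x + d| ≤ max m |x + d| := le_max_right _ _
  have hss : s ≤ s' := abs_le_of_sq_le_sq' (by nlinarith) hs' |>.2
  have hsd : s' ≤ s + |d| := abs_le_of_sq_le_sq' (by nlinarith) (by positivity) |>.2
  have hx2 : (x + d) ^ 2 ≤ (max m |x + d|) ^ 2 := by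
    rw [← sq_abs (x + d)]; exact pow_le_pow_left₀ (abs_nonneg _) hxm 2
  -- A jump exceeding `m + s` raises `s` by at least `|d| / 3`, which absorbs crude bounds on all
  -- other terms. For a smaller jump, the second-order error `2 * d ^ 2 / (m + s)` is at most `6 *
  -- (s' - s)`, and the growth of the denominator compensates the increase of `m / 2`.
  rcases le_or_gt (m + s) |d| with hZ | hZ
  · have a1 : ((x + d) ^ 2 + s' ^ 2) / (max m |x + d| + s') ≤ max m |x + d| + s' := by
      refine div_le_of_le_mul₀ (by linarith) (by linarith) ?_
      nlinarith [mul_nonneg (hm.trans hmm) hs']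
    have a2 : 0 ≤ (x ^ 2 + s ^ 2) / (m + s) := by positivity
    have a3 : -|d| ≤ x / (m + s) * d := by
      have : |x / (m + s) * d| ≤ |d| := by
        rw [abs_mul, abs_div, abs_of_nonneg (show 0 ≤ m + s by linarith)]
        exact mul_le_of_le_one_left hd (div_le_one_of_le₀ (by linarith) (by linarith))
      exact (abs_le.1 this).1
    have a4 : s + |d| / 3 ≤ s' := abs_le_of_sq_le_sq' (by nlinarith) hs' |>.2
    linarith
  · have hZ0 : 0 < m + s := hd.trans_lt hZ
    have hZ1 : m + s ≤ max m |x + d| + s' := by linarith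
    have hZ' : 0 < max m |x + d| + s' := by linarith
    have b1 : 2 * d ^ 2 / (m + s) ≤ 6 * (s' - s) := by
      rw [div_le_iff₀ hZ0]
      have : d ^ 2 = (s' - s) * (s' + s) := by linarith [h]
      rw [this]
      nlinarith [mul_le_mul_of_nonneg_left (show s' + s ≤ 3 * (m + s) by linarith)
        (sub_nonneg.2 hss)]
    have b2 : (max m |x + d| - m) / 2
        ≤ ((x + d) ^ 2 + s' ^ 2) / (m + s) - ((x + d) ^ 2 + s' ^ 2) / (max m |x + d| + s') := by
      rw [div_sub_div _ _ hZ0.ne' hZ'.ne', le_div_iff₀ (by positivity)]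
      rcases le_total |x + d| m with hc | hc
      · rw [max_eq_left hc] at hZ1 ⊢
        nlinarith [mul_nonneg (add_nonneg (sq_nonneg (x + d)) (sq_nonneg s')) (sub_nonneg.2 hss)]
      · rw [max_eq_right hc] at hZ1 hZ' ⊢
        rw [← sq_abs (x + d)]
        generalize |x + d| = M at *
        have c1 : (M + s') ^ 2 ≤ 2 * (M ^ 2 + s' ^ 2) := by nlinarith [sq_nonneg (M - s')]
        have c2 : (M - m) * ((m + s) * (M + s')) ≤ ((M + s') - (m + s)) * (M + s') ^ 2 := by
          rw [sq, ← mul_assoc, ← mul_assoc]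
          refine mul_le_mul_of_nonneg_right ?_ hZ'.le
          exact mul_le_mul (by linarith) hZ1 hZ0.le (by linarith)
        have c3 := mul_le_mul_of_nonneg_left c1 (sub_nonneg.2 hZ1)
        nlinarith
    have e : (x ^ 2 + s ^ 2) / (m + s) + 2 * (x / (m + s) * d)
        = ((x + d) ^ 2 + s' ^ 2) / (m + s) - 2 * d ^ 2 / (m + s) := by
      rw [h]; field_simp; ring
    linarith

/-- Pathwise Davis inequality: the square function is dominated by the maximal function up to a
discrete stochastic integral. -/
lemma sqrt_pathSq_le (x : ℕ → ℝ) (hx : x 0 = 0) (n : ℕ) :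
    √(pathSq x n) ≤ 2 * pathMax x n
      - ∑ i ∈ Finset.range n, x i / pathMax x i * (x (i + 1) - x i) := by
  have key : (pathSq x n - x n ^ 2) / pathMax x n - 2 * pathMax x n
      ≤ - 2 * ∑ i ∈ Finset.range n, x i / pathMax x i * (x (i + 1) - x i) := by
    induction n with
    | zero => simp [pathMax_zero, hx]
    | succ n ih =>
      have := sq_max_potential_step (d := x (n + 1) - x n) (abs_le_pathMax x le_rfl)
        (pathSq_nonneg x n) pathSq_eq_zero_of_pathMax
      rw [add_sub_cancel] at this
      rw [pathSq_succ, pathMax_succ, Finset.sum_range_succ]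
      linarith
  have hm := pathMax_nonneg x n
  have hs := Real.sq_sqrt (pathSq_nonneg x n)
  rcases hm.eq_or_lt with h0 | hm
  · rw [pathSq_eq_zero_of_pathMax h0.symm] at key ⊢
    rw [← h0] at key ⊢
    simp at key ⊢
    linarith
  -- The arithmetic-geometric mean inequality converts the quotient in the potential back into the
  -- square function itself.
  have h1 : 2 * √(pathSq x n) ≤ pathSq x n / pathMax x n + pathMax x n := by
    rw [← sub_le_iff_le_add, le_div_iff₀ hm]
    nlinarith [sq_nonneg (√(pathSq x n) - pathMax x n)]
  have h2 : x n ^ 2 / pathMax x n ≤ pathMax x n := by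
    rw [div_le_iff₀ hm, ← sq_abs, ← sq]
    exact pow_le_pow_left₀ (abs_nonneg _) (abs_le_pathMax x le_rfl) 2
  rw [sub_div] at key
  linarith

/-- Pathwise Davis inequality: the maximal function is dominated by the square function up to a
discrete stochastic integral. -/
lemma pathMax_le_sqrt (x : ℕ → ℝ) (hx : x 0 = 0) (n : ℕ) :
    pathMax x n ≤ 40 * √(pathSq x n)
      + 4 * ∑ i ∈ Finset.range n, x i / (pathMax x i + √(pathSq x i)) * (x (i + 1) - x i) := by
  have key : (x n ^ 2 + √(pathSq x n) ^ 2) / (pathMax x n + √(pathSq x n)) + pathMax x n / 2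
        - 20 * √(pathSq x n)
      ≤ 2 * ∑ i ∈ Finset.range n, x i / (pathMax x i + √(pathSq x i)) * (x (i + 1) - x i) := by
    induction n with
    | zero => simp [pathMax_zero, pathSq_zero, hx]
    | succ n ih =>
      have := max_sq_potential_step (m := pathMax x n) (d := x (n + 1) - x n) (s' := √(pathSq x (n + 1)))
        (abs_le_pathMax x le_rfl) (Real.sqrt_nonneg (pathSq x n)) (Real.sqrt_nonneg _)
        (by rw [Real.sq_sqrt (pathSq_nonneg _ _), Real.sq_sqrt (pathSq_nonneg _ _), pathSq_succ])
      rw [add_sub_cancel] at this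
      rw [pathMax_succ, Finset.sum_range_succ]
      linarith
  have : 0 ≤ (x n ^ 2 + √(pathSq x n) ^ 2) / (pathMax x n + √(pathSq x n)) :=
    div_nonneg (by positivity) (add_nonneg (pathMax_nonneg _ _) (Real.sqrt_nonneg _))
  linarith

/-! ### Bounded adapted functions and martingale increments -/

variable {Ω : Type*} {m0 : MeasurableSpace Ω} {μ : Measure Ω} {ℱ : Filtration ℕ m0}

/-- Bounded functions that are measurable for the sigma-algebra `m`. -/
def BddMeas (m : MeasurableSpace Ω) (v : Ω → ℝ) : Prop :=
  StronglyMeasurable[m] v ∧ ∃ C, ∀ ω, |v ω| ≤ C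

namespace BddMeas

variable {m m' : MeasurableSpace Ω} {u v : Ω → ℝ}

lemma mono (hv : BddMeas m v) (h : m ≤ m') : BddMeas m' v := ⟨hv.1.mono h, hv.2⟩

lemma const (c : ℝ) : BddMeas m fun _ => c := ⟨stronglyMeasurable_const, |c|, fun _ => le_rfl⟩

lemma add (hu : BddMeas m u) (hv : BddMeas m v) : BddMeas m fun ω => u ω + v ω := by
  obtain ⟨hu, C, hC⟩ := hu
  obtain ⟨hv, D, hD⟩ := hv
  exact ⟨hu.add hv, C + D, fun ω => (abs_add_le _ _).trans (add_le_add (hC ω) (hD ω))⟩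

lemma sub (hu : BddMeas m u) (hv : BddMeas m v) : BddMeas m fun ω => u ω - v ω := by
  obtain ⟨hu, C, hC⟩ := hu
  obtain ⟨hv, D, hD⟩ := hv
  exact ⟨hu.sub hv, C + D, fun ω => (abs_sub _ _).trans (add_le_add (hC ω) (hD ω))⟩

lemma mul (hu : BddMeas m u) (hv : BddMeas m v) : BddMeas m fun ω => u ω * v ω := by
  obtain ⟨hu, C, hC⟩ := hu
  obtain ⟨hv, D, hD⟩ := hv
  refine ⟨hu.mul hv, C * D, fun ω => ?_⟩
  rw [abs_mul]
  exact mul_le_mul (hC ω) (hD ω) (abs_nonneg _) ((abs_nonneg _).trans (hC ω))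

lemma abs (hu : BddMeas m u) : BddMeas m fun ω => |u ω| :=
  ⟨hu.1.norm, hu.2.imp fun _ hC ω => (abs_abs _).le.trans (hC ω)⟩

lemma max (hu : BddMeas m u) (hv : BddMeas m v) : BddMeas m fun ω => max (u ω) (v ω) := by
  obtain ⟨hu, C, hC⟩ := hu
  obtain ⟨hv, D, hD⟩ := hv
  exact ⟨hu.sup hv, Max.max C D, fun ω => abs_max_le_max_abs_abs.trans (max_le_max (hC ω) (hD ω))⟩

lemma rpow (hu : BddMeas m u) (h0 : ∀ ω, 0 ≤ u ω) {r : ℝ} (hr : 0 ≤ r) :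
    BddMeas m fun ω => u ω ^ r := by
  obtain ⟨hu, C, hC⟩ := hu
  refine ⟨(hu.measurable.pow_const r).stronglyMeasurable, C ^ r, fun ω => ?_⟩
  rw [abs_of_nonneg (Real.rpow_nonneg (h0 ω) _)]
  exact Real.rpow_le_rpow (h0 ω) ((le_abs_self _).trans (hC ω)) hr

lemma sqrt (hu : BddMeas m u) : BddMeas m fun ω => √(u ω) := by
  obtain ⟨hu, C, hC⟩ := hu
  refine ⟨hu.measurable.sqrt.stronglyMeasurable, √C, fun ω => ?_⟩
  rw [abs_of_nonneg (Real.sqrt_nonneg _)]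
  exact Real.sqrt_le_sqrt ((le_abs_self _).trans (hC ω))

lemma sum {ι : Type*} (s : Finset ι) {u : ι → Ω → ℝ} (hu : ∀ i ∈ s, BddMeas m (u i)) :
    BddMeas m fun ω => ∑ i ∈ s, u i ω := by
  classical
  induction s using Finset.induction_on with
  | empty => simpa using const 0
  | insert i s hi ih =>
    simp only [Finset.sum_insert hi]
    exact (hu i (by simp)).add (ih fun j hj => hu j (by simp [hj]))

/-- Keeps the Davis integrands bounded by 1, also where the denominator vanishes. -/
lemma div_of_abs_le (hu : BddMeas m u) (hv : BddMeas m v) (h : ∀ ω, |u ω| ≤ v ω) :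
    BddMeas m fun ω => u ω / v ω := by
  refine ⟨(hu.1.measurable.div hv.1.measurable).stronglyMeasurable, 1, fun ω => ?_⟩
  have h0 := (abs_nonneg _).trans (h ω)
  rw [abs_div, abs_of_nonneg h0]
  exact div_le_one_of_le₀ (h ω) h0

lemma integrable [IsFiniteMeasure μ] (hu : BddMeas m u) (hm : m ≤ m0) : Integrable u μ := by
  obtain ⟨hu, C, hC⟩ := hu
  exact Integrable.of_bound (hu.mono hm).aestronglyMeasurable C (.of_forall hC)

end BddMeas

lemma integral_mul_martingale_increment [IsFiniteMeasure μ] {g : ℕ → Ω → ℝ}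
    (hg : Martingale g ℱ μ) {i : ℕ} {v : Ω → ℝ} (hv : BddMeas (ℱ i) v) :
    ∫ ω, v ω * (g (i + 1) ω - g i ω) ∂μ = 0 := by
  obtain ⟨hv, C, hC⟩ := hv
  have hint : Integrable (g (i + 1) - g i) μ := (hg.integrable _).sub (hg.integrable _)
  have h1 := condExp_stronglyMeasurable_mul_of_bound (ℱ.le i) hv hint C (.of_forall hC)
  have h2 : μ[g (i + 1) - g i | ℱ i] =ᵐ[μ] 0 := by
    filter_upwards [condExp_sub (hg.integrable (i + 1)) (hg.integrable i) (ℱ i),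
      hg.2 i (i + 1) (Nat.le_succ i), hg.2 i i le_rfl] with ω a b c
    rw [a, Pi.sub_apply, b, c, sub_self, Pi.zero_apply]
  have h3 : μ[v * (g (i + 1) - g i) | ℱ i] =ᵐ[μ] 0 := by
    filter_upwards [h1, h2] with ω a b
    rw [a, Pi.mul_apply, b, Pi.zero_apply, mul_zero]
  calc ∫ ω, v ω * (g (i + 1) ω - g i ω) ∂μ = ∫ ω, (v * (g (i + 1) - g i)) ω ∂μ := rfl
    _ = ∫ ω, (μ[v * (g (i + 1) - g i) | ℱ i]) ω ∂μ := (integral_condExp (ℱ.le i)).symm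
    _ = 0 := by rw [integral_congr_ae h3]; simp

/-! ### Garsia's lemma -/

lemma young_rpow_sub_one {p : ℝ} (hp : 1 ≤ p) {a b : ℝ} (ha : 0 ≤ a) (hb : 0 ≤ b) :
    a * b ^ (p - 1) ≤ p⁻¹ * a ^ p + (1 - p⁻¹) * b ^ p := by
  have hp0 : 0 < p := by linarith
  have h := Real.geom_mean_le_arith_mean2_weighted (w₁ := p⁻¹) (w₂ := 1 - p⁻¹) (by positivity)
    (sub_nonneg.2 (inv_le_one_of_one_le₀ hp)) (Real.rpow_nonneg ha p) (Real.rpow_nonneg hb p)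
    (by ring)
  rwa [← Real.rpow_mul ha, ← Real.rpow_mul hb, mul_inv_cancel₀ hp0.ne', Real.rpow_one, mul_sub,
    mul_inv_cancel₀ hp0.ne', mul_one] at h

/-- Summation by parts turns the sum into that of `a (l + 1) ^ (p - 1) * (a (l + 1) - a l)`, and by
convexity `p` times each term is at least the increment of `a ^ p`. -/
lemma rpow_le_mul_sum_mul_sub {p : ℝ} (hp : 1 ≤ p) {a b : ℕ → ℝ} (ha0 : a 0 = 0)
    (ha : ∀ n, 0 ≤ a n) (hb0 : b 0 = 0) (hb : ∀ n, b (n + 1) = a (n + 1) ^ (p - 1)) (n : ℕ) :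
    a n ^ p ≤ p * ∑ l ∈ Finset.range n, (b (l + 1) - b l) * (a n - a l) := by
  have hp0 : 0 < p := by linarith
  induction n with
  | zero => simp [ha0, Real.zero_rpow hp0.ne']
  | succ n ih =>
    have e : ∑ l ∈ Finset.range (n + 1), (b (l + 1) - b l) * (a (n + 1) - a l)
        = ∑ l ∈ Finset.range n, (b (l + 1) - b l) * (a n - a l)
          + a (n + 1) ^ (p - 1) * (a (n + 1) - a n) := by
      have : ∀ l, (b (l + 1) - b l) * (a (n + 1) - a l)
          = (b (l + 1) - b l) * (a n - a l) + (b (l + 1) - b l) * (a (n + 1) - a n) :=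
        fun l => by ring
      rw [Finset.sum_congr rfl fun l _ => this l, Finset.sum_add_distrib, ← Finset.sum_mul,
        Finset.sum_range_sub, hb0, sub_zero, hb, Finset.sum_range_succ, sub_self, mul_zero, add_zero]
    have h1 := young_rpow_sub_one hp (ha n) (ha (n + 1))
    have h2 : a (n + 1) ^ p = a (n + 1) ^ (p - 1) * a (n + 1) := by
      rw [← Real.rpow_add_one' (ha _) (by linarith), sub_add_cancel]
    have h3 := mul_le_mul_of_nonneg_left h1 hp0.le
    rw [mul_add, ← mul_assoc, ← mul_assoc, ← mul_assoc, mul_inv_cancel₀ hp0.ne', mul_sub,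
      mul_inv_cancel₀ hp0.ne'] at h3
    have h4 := congrArg (p * ·) h2
    rw [e]
    linarith

/-- **Garsia's lemma** for bounded processes. -/
lemma integral_rpow_le_of_tail_le [IsFiniteMeasure μ] {p : ℝ} (hp : 1 ≤ p) {C : ℝ} (hC : 0 ≤ C)
    {A : ℕ → Ω → ℝ} (hA : ∀ n, BddMeas (ℱ n) (A n)) (hmono : ∀ ω, Monotone fun n => A n ω)
    (hA0 : ∀ ω, A 0 ω = 0) {Y : Ω → ℝ} (hY : BddMeas m0 Y) (hY0 : ∀ ω, 0 ≤ Y ω) (N : ℕ)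
    (h : ∀ l < N, ∀ w, BddMeas (ℱ (l + 1)) w → (∀ ω, 0 ≤ w ω) →
      ∫ ω, w ω * (A N ω - A l ω) ∂μ ≤ C * ∫ ω, w ω * Y ω ∂μ) :
    ∫ ω, A N ω ^ p ∂μ ≤ (p * C) ^ p * ∫ ω, Y ω ^ p ∂μ := by
  have hp0 : 0 < p := by linarith
  have hAnn : ∀ n ω, 0 ≤ A n ω := fun n ω => (hA0 ω).ge.trans (hmono ω (Nat.zero_le n))
  -- The value at time 0 is imposed because `0 ^ (p - 1)` equals 1 when `p = 1`, which would break
  -- the telescoping.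
  set b : ℕ → Ω → ℝ := fun n ω => if n = 0 then 0 else A n ω ^ (p - 1) with hb
  have hbm : ∀ n, BddMeas (ℱ n) (b n) := by
    intro n
    by_cases hn : n = 0
    · simpa [hb, hn] using BddMeas.const 0
    · simpa [hb, hn] using (hA n).rpow (hAnn n) (by linarith)
  have hbmono : ∀ l ω, b l ω ≤ b (l + 1) ω := by
    intro l ω
    by_cases hl : l = 0
    · simpa [hb, hl] using Real.rpow_nonneg (hAnn 1 ω) _
    · simpa [hb, hl] using Real.rpow_le_rpow (hAnn l ω) (hmono ω l.le_succ) (by linarith)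
  have hbN : ∀ ω, b N ω ≤ A N ω ^ (p - 1) := by
    intro ω
    by_cases hN : N = 0
    · simpa [hb, hN] using Real.rpow_nonneg (hAnn 0 ω) _
    · simp [hb, hN]
  have hw : ∀ l, BddMeas (ℱ (l + 1)) fun ω => b (l + 1) ω - b l ω :=
    fun l => (hbm (l + 1)).sub ((hbm l).mono (ℱ.mono l.le_succ))
  have hA' : ∀ n, BddMeas m0 (A n) := fun n => (hA n).mono (ℱ.le n)
  have hw' : ∀ l, BddMeas m0 fun ω => b (l + 1) ω - b l ω := fun l => (hw l).mono (ℱ.le _)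
  have hAp : BddMeas m0 fun ω => A N ω ^ p := (hA' N).rpow (hAnn N) hp0.le
  have hYp : BddMeas m0 fun ω => Y ω ^ p := hY.rpow hY0 hp0.le
  -- The increments of `b` serve as the weights in the tail hypothesis. They are measurable only at
  -- time `l + 1`, which is why the hypothesis allows such weights.
  have step1 : ∫ ω, A N ω ^ p ∂μ ≤ p * (C * ∫ ω, b N ω * Y ω ∂μ) := by
    calc ∫ ω, A N ω ^ p ∂μ
        ≤ ∫ ω, p * ∑ l ∈ Finset.range N, (b (l + 1) ω - b l ω) * (A N ω - A l ω) ∂μ := by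
          refine integral_mono (hAp.integrable le_rfl)
            (((BddMeas.sum _ fun l _ => (hw' l).mul ((hA' N).sub (hA' l))).integrable
              le_rfl).const_mul p) fun ω => ?_
          exact rpow_le_mul_sum_mul_sub hp (a := fun n => A n ω) (b := fun n => b n ω) (hA0 ω)
            (fun n => hAnn n ω) (by simp [hb]) (fun n => by simp [hb]) N
      _ = p * ∑ l ∈ Finset.range N, ∫ ω, (b (l + 1) ω - b l ω) * (A N ω - A l ω) ∂μ := by
          rw [integral_const_mul, integral_finsetSum]
          exact fun l _ => ((hw' l).mul ((hA' N).sub (hA' l))).integrable le_rfl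
      _ ≤ p * ∑ l ∈ Finset.range N, C * ∫ ω, (b (l + 1) ω - b l ω) * Y ω ∂μ := by
          gcongr with l hl
          exact h l (Finset.mem_range.1 hl) _ (hw l) fun ω => sub_nonneg.2 (hbmono l ω)
      _ = p * (C * ∫ ω, b N ω * Y ω ∂μ) := by
          rw [← Finset.mul_sum, ← integral_finsetSum]
          · congr 3
            ext ω
            rw [← Finset.sum_mul, Finset.sum_range_sub (fun n => b n ω)]
            simp [hb]
          · exact fun l _ => ((hw' l).mul hY).integrable le_rfl
  -- Young's inequality leaves the fraction `1 - p⁻¹` of the left-hand side, which is then absorbed.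
  have step2 : p * (C * ∫ ω, b N ω * Y ω ∂μ)
      ≤ p⁻¹ * ((p * C) ^ p * ∫ ω, Y ω ^ p ∂μ) + (1 - p⁻¹) * ∫ ω, A N ω ^ p ∂μ := by
    rw [← mul_assoc, ← mul_assoc, ← integral_const_mul, ← integral_const_mul, ← integral_const_mul,
      ← integral_add ((hYp.integrable le_rfl).const_mul _) ((hAp.integrable le_rfl).const_mul _)]
    refine integral_mono ((((hbm N).mono (ℱ.le N)).mul hY |>.integrable le_rfl).const_mul _)
      (((hYp.integrable le_rfl).const_mul _).add ((hAp.integrable le_rfl).const_mul _)) fun ω => ?_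
    have h1 := young_rpow_sub_one hp (mul_nonneg (mul_nonneg hp0.le hC) (hY0 ω)) (hAnn N ω)
    rw [Real.mul_rpow (mul_nonneg hp0.le hC) (hY0 ω)] at h1
    have h2 := mul_le_mul_of_nonneg_left (hbN ω) (mul_nonneg (mul_nonneg hp0.le hC) (hY0 ω))
    simp only
    linarith
  have h3 : p⁻¹ * ∫ ω, A N ω ^ p ∂μ ≤ p⁻¹ * ((p * C) ^ p * ∫ ω, Y ω ^ p ∂μ) := by linarith
  exact le_of_mul_le_mul_left h3 (by positivity)

/-! ### Finite-horizon `L_p` inequalities for bounded martingales -/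

lemma bddMeas_pathSq {g : ℕ → Ω → ℝ} (hg : ∀ n, BddMeas (ℱ n) (g n)) (n : ℕ) :
    BddMeas (ℱ n) fun ω => pathSq (fun i => g i ω) n := by
  refine BddMeas.sum _ fun i hi => ?_
  have hi := Finset.mem_range.1 hi
  have h := ((hg (i + 1)).mono (ℱ.mono hi)).sub ((hg i).mono (ℱ.mono hi.le))
  simpa only [sq] using h.mul h

lemma bddMeas_pathMax {g : ℕ → Ω → ℝ} (hg : ∀ n, BddMeas (ℱ n) (g n)) (n : ℕ) :
    BddMeas (ℱ n) fun ω => pathMax (fun i => g i ω) n := by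
  induction n with
  | zero => simpa only [pathMax_zero] using (hg 0).abs
  | succ n ih =>
    simp only [pathMax_succ]
    exact (ih.mono (ℱ.mono n.le_succ)).max (hg (n + 1)).abs

lemma bddMeas_shift {g : ℕ → Ω → ℝ} (hg : ∀ n, BddMeas (ℱ n) (g n)) (l n : ℕ) :
    BddMeas (ℱ (l + n)) fun ω => g (l + n) ω - g l ω :=
  (hg (l + n)).sub ((hg l).mono (ℱ.mono (Nat.le_add_right l n)))

/-- The weight is orthogonal to the increments after time `l + 1`. The increment from `l` to `l +
1`, to which it need not be orthogonal, is killed by `H 0 = 0`; this holds in the applications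
because the restarted path begins at 0. -/
lemma integral_mul_stochasticSum [IsFiniteMeasure μ] {g : ℕ → Ω → ℝ} (hg : Martingale g ℱ μ)
    (hb : ∀ n, BddMeas (ℱ n) (g n)) {l : ℕ} {w : Ω → ℝ} (hw : BddMeas (ℱ (l + 1)) w)
    {H : ℕ → Ω → ℝ} (hH : ∀ i, BddMeas (ℱ (l + i)) (H i)) (hH0 : ∀ ω, H 0 ω = 0) (n : ℕ) :
    ∫ ω, w ω * ∑ i ∈ Finset.range n,
      H i ω * ((g (l + (i + 1)) ω - g l ω) - (g (l + i) ω - g l ω)) ∂μ = 0 := by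
  have hint : ∀ i, Integrable (fun ω => w ω *
      (H i ω * ((g (l + (i + 1)) ω - g l ω) - (g (l + i) ω - g l ω)))) μ := fun i =>
    ((hw.mono (ℱ.le _)).mul (((hH i).mono (ℱ.le _)).mul
      (((bddMeas_shift hb l (i + 1)).mono (ℱ.le _)).sub
        ((bddMeas_shift hb l i).mono (ℱ.le _))))).integrable le_rfl
  simp only [Finset.mul_sum]
  rw [integral_finsetSum _ fun i _ => hint i]
  refine Finset.sum_eq_zero fun i _ => ?_
  rcases i with _ | i
  · simp [hH0]
  · have := integral_mul_martingale_increment hg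
      ((hw.mono (ℱ.mono (show l + 1 ≤ l + (i + 1) by omega))).mul (hH (i + 1)))
    rw [← this]
    congr 1
    ext ω
    rw [show l + (i + 1 + 1) = l + (i + 1) + 1 by omega]
    ring

lemma integral_sqrt_pathSq_rpow_le [IsFiniteMeasure μ] {p : ℝ} (hp : 1 ≤ p) {g : ℕ → Ω → ℝ}
    (hg : Martingale g ℱ μ) (hb : ∀ n, BddMeas (ℱ n) (g n)) (N : ℕ) :
    ∫ ω, √(pathSq (fun i => g i ω) N) ^ p ∂μ
      ≤ (p * 4) ^ p * ∫ ω, pathMax (fun i => g i ω) N ^ p ∂μ := by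
  refine integral_rpow_le_of_tail_le hp (by norm_num)
    (A := fun n ω => √(pathSq (fun i => g i ω) n)) (fun n => (bddMeas_pathSq hb n).sqrt)
    (fun ω i j hij => Real.sqrt_le_sqrt (pathSq_mono _ hij)) (fun ω => by simp [pathSq_zero])
    ((bddMeas_pathMax hb N).mono (ℱ.le N)) (fun ω => pathMax_nonneg _ _) N ?_
  intro l hl w hw hw0
  obtain ⟨n, rfl⟩ := Nat.exists_eq_add_of_le hl.le
  set y : Ω → ℕ → ℝ := fun ω i => g (l + i) ω - g l ω with hy
  have hM : ∀ i, BddMeas (ℱ (l + i)) fun ω => pathMax (y ω) i := fun i =>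
    bddMeas_pathMax (ℱ := ⟨fun k => ℱ (l + k), fun a b h => ℱ.mono (by omega), fun k => ℱ.le _⟩)
      (g := fun i ω => y ω i) (fun k => bddMeas_shift hb l k) i
  have hH : ∀ i, BddMeas (ℱ (l + i)) fun ω => y ω i / pathMax (y ω) i := fun i =>
    (bddMeas_shift hb l i).div_of_abs_le (hM i) fun ω => abs_le_pathMax (y ω) le_rfl
  have h0 := integral_mul_stochasticSum hg hb hw hH (fun ω => by simp [hy]) n
  have hw' := hw.mono (ℱ.le _)
  have hYi := ((hw'.mul ((bddMeas_pathMax hb (l + n)).mono (ℱ.le _))).integrable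
    (μ := μ) le_rfl).const_mul 4
  have hDi : Integrable (fun ω => w ω * ∑ i ∈ Finset.range n,
      y ω i / pathMax (y ω) i * (y ω (i + 1) - y ω i)) μ :=
    (hw'.mul (BddMeas.sum _ fun i _ => ((hH i).mono (ℱ.le _)).mul
      (((bddMeas_shift hb l (i + 1)).mono (ℱ.le _)).sub
        ((bddMeas_shift hb l i).mono (ℱ.le _))))).integrable le_rfl
  calc _ ≤ ∫ ω, (4 * (w ω * pathMax (fun i => g i ω) (l + n))
          - w ω * ∑ i ∈ Finset.range n, y ω i / pathMax (y ω) i * (y ω (i + 1) - y ω i)) ∂μ := by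
        refine integral_mono ((hw'.mul (((bddMeas_pathSq hb _).sqrt.mono (ℱ.le _)).sub
          ((bddMeas_pathSq hb _).sqrt.mono (ℱ.le _)))).integrable le_rfl) (hYi.sub hDi)
          fun ω => ?_
        have h1 := sqrt_pathSq_sub_le (fun i => g i ω) l n
        have h2 := sqrt_pathSq_le (y ω) (by simp [hy]) n
        -- Restarting the path costs a factor 2 in the maximum; with the 2 of the pathwise
        -- inequality this gives the constant 4.
        have h3 := pathMax_shift_le (fun i => g i ω) l n
        have h4 := mul_le_mul_of_nonneg_left
          (h1.trans (h2.trans (sub_le_sub_right (mul_le_mul_of_nonneg_left h3 zero_le_two) _)))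
          (hw0 ω)
        simp only
        linarith
    _ = _ := by rw [integral_sub hYi hDi, h0, sub_zero, integral_const_mul]

lemma integral_pathMax_rpow_le [IsFiniteMeasure μ] {p : ℝ} (hp : 1 ≤ p) {g : ℕ → Ω → ℝ}
    (hg : Martingale g ℱ μ) (hb : ∀ n, BddMeas (ℱ n) (g n)) (hg0 : ∀ ω, g 0 ω = 0) (N : ℕ) :
    ∫ ω, pathMax (fun i => g i ω) N ^ p ∂μ
      ≤ (p * 40) ^ p * ∫ ω, √(pathSq (fun i => g i ω) N) ^ p ∂μ := by
  refine integral_rpow_le_of_tail_le hp (by norm_num)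
    (A := fun n ω => pathMax (fun i => g i ω) n) (fun n => bddMeas_pathMax hb n)
    (fun ω i j hij => pathMax_mono _ hij) (fun ω => by simp [pathMax_zero, hg0])
    ((bddMeas_pathSq hb N).sqrt.mono (ℱ.le N)) (fun ω => Real.sqrt_nonneg _) N ?_
  intro l hl w hw hw0
  obtain ⟨n, rfl⟩ := Nat.exists_eq_add_of_le hl.le
  set y : Ω → ℕ → ℝ := fun ω i => g (l + i) ω - g l ω with hy
  have hM : ∀ i, BddMeas (ℱ (l + i)) fun ω => pathMax (y ω) i + √(pathSq (y ω) i) := fun i =>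
    let 𝒢 : Filtration ℕ m0 :=
      ⟨fun k => ℱ (l + k), fun a b h => ℱ.mono (by omega), fun k => ℱ.le _⟩
    (bddMeas_pathMax (ℱ := 𝒢) (g := fun i ω => y ω i) (fun k => bddMeas_shift hb l k) i).add
      (bddMeas_pathSq (ℱ := 𝒢) (g := fun i ω => y ω i) (fun k => bddMeas_shift hb l k) i).sqrt
  have hH : ∀ i, BddMeas (ℱ (l + i)) fun ω => y ω i / (pathMax (y ω) i + √(pathSq (y ω) i)) :=
    fun i => (bddMeas_shift hb l i).div_of_abs_le (hM i) fun ω =>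
      (abs_le_pathMax (y ω) le_rfl).trans (le_add_of_nonneg_right (Real.sqrt_nonneg _))
  have h0 := integral_mul_stochasticSum hg hb hw hH (fun ω => by simp [hy]) n
  have hw' := hw.mono (ℱ.le _)
  have hYi := ((hw'.mul ((bddMeas_pathSq hb (l + n)).sqrt.mono (ℱ.le _))).integrable
    (μ := μ) le_rfl).const_mul 40
  have hDi : Integrable (fun ω => 4 * (w ω * ∑ i ∈ Finset.range n,
      y ω i / (pathMax (y ω) i + √(pathSq (y ω) i)) * (y ω (i + 1) - y ω i))) μ :=
    ((hw'.mul (BddMeas.sum _ fun i _ => ((hH i).mono (ℱ.le _)).mul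
      (((bddMeas_shift hb l (i + 1)).mono (ℱ.le _)).sub
        ((bddMeas_shift hb l i).mono (ℱ.le _))))).integrable le_rfl).const_mul 4
  calc _ ≤ ∫ ω, (40 * (w ω * √(pathSq (fun i => g i ω) (l + n)))
          + 4 * (w ω * ∑ i ∈ Finset.range n,
            y ω i / (pathMax (y ω) i + √(pathSq (y ω) i)) * (y ω (i + 1) - y ω i))) ∂μ := by
        refine integral_mono ((hw'.mul (((bddMeas_pathMax hb _).mono (ℱ.le _)).sub
          ((bddMeas_pathMax hb _).mono (ℱ.le _)))).integrable le_rfl) (hYi.add hDi)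
          fun ω => ?_
        have h1 := pathMax_sub_le (fun i => g i ω) l n
        have h2 := pathMax_le_sqrt (y ω) (by simp [hy]) n
        have h3 : √(pathSq (y ω) n) ≤ √(pathSq (fun i => g i ω) (l + n)) :=
          Real.sqrt_le_sqrt <| by
            have := pathSq_shift (fun i => g i ω) l n
            have h4 := pathSq_nonneg (fun i => g i ω) l
            simp only [hy]
            linarith
        have h4 := mul_le_mul_of_nonneg_left (h1.trans h2) (hw0 ω)
        have h5 := mul_le_mul_of_nonneg_left h3 (hw0 ω)
        simp only
        linarith
    _ = _ := by
        rw [integral_add hYi hDi, integral_const_mul, integral_const_mul, h0, mul_zero, add_zero]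

/-! ### Restriction to initial events and passage to the infinite horizon -/

lemma martingale_indicator {f : ℕ → Ω → ℝ} (hf : Martingale f ℱ μ) {s : Set Ω}
    (hs : MeasurableSet[ℱ 0] s) : Martingale (fun n => s.indicator (f n)) ℱ μ := by
  have hs' : ∀ n, MeasurableSet[ℱ n] s := fun n => ℱ.mono (Nat.zero_le n) _ hs
  refine ⟨fun n => (hf.1 n).indicator (hs' n), fun i j hij => ?_⟩
  filter_upwards [condExp_indicator (hf.integrable j) (hs' i), hf.2 i j hij] with ω h1 h2
  rw [h1]
  by_cases hω : ω ∈ s <;> simp [hω, h2]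

lemma lintegral_iSup_ofReal_le [IsFiniteMeasure μ] {a b : ℕ → Ω → ℝ} {K : ℝ} (hK : 0 ≤ K)
    (ha : ∀ n, BddMeas m0 (a n)) (hb : ∀ n, BddMeas m0 (b n)) (ha0 : ∀ n ω, 0 ≤ a n ω)
    (hb0 : ∀ n ω, 0 ≤ b n ω) (hmono : ∀ ω, Monotone fun n => a n ω)
    (h : ∀ n, ∫ ω, a n ω ∂μ ≤ K * ∫ ω, b n ω ∂μ) :
    ∫⁻ ω, ⨆ n, ENNReal.ofReal (a n ω) ∂μ
      ≤ ENNReal.ofReal K * ∫⁻ ω, ⨆ n, ENNReal.ofReal (b n ω) ∂μ := by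
  rw [lintegral_iSup (fun n => (ha n).1.measurable.ennreal_ofReal)
    fun i j hij ω => ENNReal.ofReal_le_ofReal (hmono ω hij)]
  refine iSup_le fun n => ?_
  calc ∫⁻ ω, ENNReal.ofReal (a n ω) ∂μ = ENNReal.ofReal (∫ ω, a n ω ∂μ) :=
        (ofReal_integral_eq_lintegral_ofReal ((ha n).integrable le_rfl)
          (.of_forall (ha0 n))).symm
    _ ≤ ENNReal.ofReal (K * ∫ ω, b n ω ∂μ) := ENNReal.ofReal_le_ofReal (h n)
    _ = ENNReal.ofReal K * ∫⁻ ω, ENNReal.ofReal (b n ω) ∂μ := by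
        rw [ENNReal.ofReal_mul hK, ofReal_integral_eq_lintegral_ofReal ((hb n).integrable le_rfl)
          (.of_forall (hb0 n))]
    _ ≤ _ := by
        gcongr with ω
        exact le_iSup (fun n => ENNReal.ofReal (b n ω)) n

lemma iSup_ofReal_rpow {a : ℕ → ℝ} (ha : ∀ n, 0 ≤ a n) {p : ℝ} (hp : 0 < p) :
    (⨆ n, ENNReal.ofReal (a n)) ^ p = ⨆ n, ENNReal.ofReal (a n ^ p) := by
  have h := (ENNReal.orderIsoRpow p hp).map_iSup fun n => ENNReal.ofReal (a n)
  simp only [ENNReal.orderIsoRpow_apply] at h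
  rw [h]
  exact iSup_congr fun n => ENNReal.ofReal_rpow_of_nonneg (ha n) hp.le

lemma quadVar_eq_iSup (f : ℕ → ℝ → ℝ) (x : ℝ) :
    quadVar f x = ⨆ n, ENNReal.ofReal √(pathSq (fun i => f i x) n) := by
  have h : ∑' n : ℕ, ‖mdiff f n x‖ₑ ^ 2 = ⨆ n, ENNReal.ofReal (pathSq (fun i => f i x) n) := by
    rw [tsum_eq_zero_add' ENNReal.summable, ENNReal.tsum_eq_iSup_nat]
    simp only [mdiff, Pi.zero_apply, enorm_zero, ne_eq, OfNat.ofNat_ne_zero, not_false_eq_true,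
      zero_pow, zero_add, Pi.sub_apply]
    refine iSup_congr fun n => ?_
    rw [pathSq, ENNReal.ofReal_sum_of_nonneg fun _ _ => sq_nonneg _]
    refine Finset.sum_congr rfl fun i _ => ?_
    rw [Real.enorm_eq_ofReal_abs, ← ENNReal.ofReal_pow (abs_nonneg _), sq_abs]
  rw [quadVar, h, iSup_ofReal_rpow (fun n => pathSq_nonneg _ n) (by norm_num)]
  simp only [Real.sqrt_eq_rpow]

lemma maximalFn_eq_iSup (f : ℕ → ℝ → ℝ) (x : ℝ) :
    maximalFn f x = ⨆ n, ENNReal.ofReal (pathMax (fun i => f i x) n) := by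
  refine le_antisymm (iSup_mono fun n => ?_) (iSup_le fun n => ?_)
  · rw [Real.enorm_eq_ofReal_abs]
    exact ENNReal.ofReal_le_ofReal (abs_le_pathMax (fun i => f i x) le_rfl)
  · have hle : ∀ n, ENNReal.ofReal |f n x| ≤ maximalFn f x := fun n => by
      rw [← Real.enorm_eq_ofReal_abs]; exact le_iSup (fun n => ‖f n x‖ₑ) n
    induction n with
    | zero => rw [pathMax_zero]; exact hle 0
    | succ n ih => rw [pathMax_succ, ENNReal.ofReal_max]; exact max_le ih (hle _)

lemma lintegral_quadVar_rpow_le {P : Measure ℝ} [IsFiniteMeasure P]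
    {ℱ : Filtration ℕ Real.measurableSpace} {p : ℝ} (hp : 1 ≤ p) {g : ℕ → ℝ → ℝ}
    (hg : Martingale g ℱ P) (hb : ∀ n, BddMeas (ℱ n) (g n)) :
    ∫⁻ x, quadVar g x ^ p ∂P ≤ ENNReal.ofReal (p * 4) ^ p * ∫⁻ x, maximalFn g x ^ p ∂P := by
  have hp0 : 0 < p := by linarith
  simp only [quadVar_eq_iSup, maximalFn_eq_iSup,
    iSup_ofReal_rpow (fun n => Real.sqrt_nonneg _) hp0,
    iSup_ofReal_rpow (fun n => pathMax_nonneg _ n) hp0]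
  rw [ENNReal.ofReal_rpow_of_nonneg (by positivity) hp0.le]
  exact lintegral_iSup_ofReal_le (by positivity)
    (fun n => ((bddMeas_pathSq hb n).sqrt.rpow (fun _ => Real.sqrt_nonneg _) hp0.le).mono (ℱ.le n))
    (fun n => ((bddMeas_pathMax hb n).rpow (fun _ => pathMax_nonneg _ _) hp0.le).mono (ℱ.le n))
    (fun n x => Real.rpow_nonneg (Real.sqrt_nonneg _) _)
    (fun n x => Real.rpow_nonneg (pathMax_nonneg _ _) _)
    (fun x i j hij => Real.rpow_le_rpow (Real.sqrt_nonneg _)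
      (Real.sqrt_le_sqrt (pathSq_mono _ hij)) hp0.le)
    (integral_sqrt_pathSq_rpow_le hp hg hb)

lemma lintegral_maximalFn_rpow_le {P : Measure ℝ} [IsFiniteMeasure P]
    {ℱ : Filtration ℕ Real.measurableSpace} {p : ℝ} (hp : 1 ≤ p) {g : ℕ → ℝ → ℝ}
    (hg : Martingale g ℱ P) (hb : ∀ n, BddMeas (ℱ n) (g n)) (hg0 : ∀ x, g 0 x = 0) :
    ∫⁻ x, maximalFn g x ^ p ∂P ≤ ENNReal.ofReal (p * 40) ^ p * ∫⁻ x, quadVar g x ^ p ∂P := by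
  have hp0 : 0 < p := by linarith
  simp only [quadVar_eq_iSup, maximalFn_eq_iSup,
    iSup_ofReal_rpow (fun n => Real.sqrt_nonneg _) hp0,
    iSup_ofReal_rpow (fun n => pathMax_nonneg _ n) hp0]
  rw [ENNReal.ofReal_rpow_of_nonneg (by positivity) hp0.le]
  exact lintegral_iSup_ofReal_le (by positivity)
    (fun n => ((bddMeas_pathMax hb n).rpow (fun _ => pathMax_nonneg _ _) hp0.le).mono (ℱ.le n))
    (fun n => ((bddMeas_pathSq hb n).sqrt.rpow (fun _ => Real.sqrt_nonneg _) hp0.le).mono (ℱ.le n))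
    (fun n x => Real.rpow_nonneg (pathMax_nonneg _ _) _)
    (fun n x => Real.rpow_nonneg (Real.sqrt_nonneg _) _)
    (fun x i j hij => Real.rpow_le_rpow (pathMax_nonneg _ _) (pathMax_mono _ hij) hp0.le)
    (integral_pathMax_rpow_le hp hg hb hg0)

/-! ### Localization to unit intervals -/

lemma dyadicSigma_le_comap (n : ℕ) :
    dyadicSigma n ≤ MeasurableSpace.comap (fun x : ℝ => ⌊x * 2 ^ n⌋) ⊤ := by
  refine MeasurableSpace.generateFrom_le ?_
  rintro _ ⟨k, rfl⟩
  refine ⟨{k}, trivial, ?_⟩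
  have h2 : (0 : ℝ) < 2 ^ n := by positivity
  ext x
  simp only [mem_preimage, mem_singleton_iff, Int.floor_eq_iff, dyadicInterval, mem_Ico,
    div_le_iff₀ h2, lt_div_iff₀ h2]

/-- A dyadically measurable function takes only finitely many values on a unit interval. -/
lemma exists_abs_le_of_dyadicSigma {n : ℕ} {f : ℝ → ℝ} (hf : StronglyMeasurable[dyadicSigma n] f)
    (j : ℤ) : ∃ C, ∀ x ∈ Ico (j : ℝ) (j + 1), |f x| ≤ C := by
  -- The function factors through `⌊x * 2 ^ n⌋`, which ranges over a finite set of integers on a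
  -- unit interval.
  obtain ⟨h, -, rfl⟩ :=
    (hf.measurable.mono (dyadicSigma_le_comap n) le_rfl).exists_eq_measurable_comp
  obtain ⟨C, hC⟩ := ((finite_Icc (j * 2 ^ n) ((j + 1) * 2 ^ n)).image fun k => |h k|).bddAbove
  refine ⟨C, fun x hx => hC ⟨⌊x * 2 ^ n⌋, ⟨?_, ?_⟩, rfl⟩⟩
  · rw [Int.le_floor]
    push_cast
    exact mul_le_mul_of_nonneg_right hx.1 (by positivity)
  · rw [← Int.cast_le (R := ℝ)]
    refine (Int.floor_le _).trans ?_
    push_cast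
    exact mul_le_mul_of_nonneg_right hx.2.le (by positivity)

lemma measurableSet_unitInterval (j : ℤ) :
    MeasurableSet[dyadicSigma 0] (Ico (j : ℝ) (j + 1)) :=
  MeasurableSpace.measurableSet_generateFrom ⟨j, by simp [dyadicInterval]⟩

/-- The martingale `f - f_0` restricted to the unit interval `[j, j + 1)`. -/
noncomputable def localize (f : ℕ → ℝ → ℝ) (j : ℤ) (n : ℕ) : ℝ → ℝ :=
  (Ico (j : ℝ) (j + 1)).indicator (f n - f 0)

section Localize

variable {P : Measure ℝ} [IsFiniteMeasure P] {f : ℕ → ℝ → ℝ}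

lemma martingale_localize (hf : Martingale f dyadicFiltration P) (j : ℤ) :
    Martingale (localize f j) dyadicFiltration P := by
  refine martingale_indicator (f := fun n => f n - f 0) ?_ (measurableSet_unitInterval j)
  refine hf.sub ⟨fun n => (hf.1 0).mono (dyadicFiltration.mono (Nat.zero_le n)), fun i k _ => ?_⟩
  rw [condExp_of_stronglyMeasurable (dyadicFiltration.le i)
    ((hf.1 0).mono (dyadicFiltration.mono (Nat.zero_le i))) (hf.integrable 0)]

lemma bddMeas_localize (hf : Martingale f dyadicFiltration P) (j : ℤ) (n : ℕ) :
    BddMeas (dyadicFiltration n) (localize f j n) := by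
  refine ⟨(martingale_localize hf j).1 n, ?_⟩
  obtain ⟨C, hC⟩ := exists_abs_le_of_dyadicSigma (n := n) (f := f n - f 0)
    ((hf.1 n).sub ((hf.1 0).mono (dyadicFiltration.mono (Nat.zero_le n)))) j
  refine ⟨max C 0, fun x => ?_⟩
  by_cases hx : x ∈ Ico (j : ℝ) (j + 1)
  · rw [localize, indicator_of_mem hx]; exact (hC x hx).trans (le_max_left _ _)
  · rw [localize, indicator_of_notMem hx, abs_zero]; exact le_max_right _ _

end Localize

/-- Subtracting `f 0` does not change the increments, so no condition on `f 0` is needed. -/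
lemma lintegral_quadVar_localize {P : Measure ℝ} (f : ℕ → ℝ → ℝ) {p : ℝ} (hp : 0 < p) (j : ℤ) :
    ∫⁻ x, quadVar (localize f j) x ^ p ∂P = ∫⁻ x in Ico (j : ℝ) (j + 1), quadVar f x ^ p ∂P := by
  rw [← lintegral_indicator measurableSet_Ico]
  congr 1
  ext x
  by_cases hx : x ∈ Ico (j : ℝ) (j + 1)
  · rw [indicator_of_mem hx]
    simp only [quadVar_eq_iSup, pathSq, localize, indicator_of_mem hx, Pi.sub_apply,
      sub_sub_sub_cancel_right]
  · rw [indicator_of_notMem hx]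
    simp [quadVar_eq_iSup, pathSq, localize, indicator_of_notMem hx, hp]

/-- The path inequalities need the value 0 at time 0 everywhere, while `f 0` vanishes only almost
surely. Subtracting it alters the maximal function on a null set only. -/
lemma lintegral_maximalFn_localize {P : Measure ℝ} {f : ℕ → ℝ → ℝ} (hf : f 0 =ᵐ[P] 0) {p : ℝ}
    (hp : 0 < p) (j : ℤ) :
    ∫⁻ x, maximalFn (localize f j) x ^ p ∂P
      = ∫⁻ x in Ico (j : ℝ) (j + 1), maximalFn f x ^ p ∂P := by
  rw [← lintegral_indicator measurableSet_Ico]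
  refine lintegral_congr_ae ?_
  filter_upwards [hf] with x h0
  by_cases hx : x ∈ Ico (j : ℝ) (j + 1)
  · rw [indicator_of_mem hx]
    simp only [maximalFn, localize, indicator_of_mem hx, Pi.sub_apply, h0, Pi.zero_apply, sub_zero]
  · rw [indicator_of_notMem hx]
    simp [maximalFn, localize, indicator_of_notMem hx, hp]

/-! ### From local estimates to amalgam norms -/

lemma amalgamNorm_le_mul {P : Measure ℝ} {p : ℝ} (hp : 0 < p) {q : ℝ≥0∞} (hq : q ≠ 0)
    {g h : ℝ → ℝ≥0∞} {K : ℝ≥0∞}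
    (hgh : ∀ j : ℤ, ∫⁻ x in Ico (j : ℝ) (j + 1), g x ^ p ∂P
      ≤ K ^ p * ∫⁻ x in Ico (j : ℝ) (j + 1), h x ^ p ∂P) :
    amalgamNorm P p q g ≤ K * amalgamNorm P p q h := by
  -- Used with `r = 1` for the supremum and with `r = q.toReal` for the sum; the outer root then
  -- restores the same `K`, so the constant does not depend on `q`.
  have key : ∀ (j : ℤ) (r : ℝ), 0 < r → (∫⁻ x in Ico (j : ℝ) (j + 1), g x ^ p ∂P) ^ (r / p)
      ≤ K ^ r * (∫⁻ x in Ico (j : ℝ) (j + 1), h x ^ p ∂P) ^ (r / p) := fun j r hr => by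
    have := ENNReal.rpow_le_rpow (hgh j) (div_pos hr hp).le
    rwa [ENNReal.mul_rpow_of_nonneg _ _ (div_pos hr hp).le, ← ENNReal.rpow_mul,
      mul_div_cancel₀ _ hp.ne'] at this
  unfold amalgamNorm
  split_ifs with hq'
  · rw [ENNReal.mul_iSup]
    exact iSup_mono fun j => by simpa using key j 1 one_pos
  · have hq0 : 0 < q.toReal := ENNReal.toReal_pos hq hq'
    calc _ ≤ (∑' j : ℤ, K ^ q.toReal
            * (∫⁻ x in Ico (j : ℝ) (j + 1), h x ^ p ∂P) ^ (q.toReal / p)) ^ (1 / q.toReal) := by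
          gcongr with j
          exact key j _ hq0
      _ = _ := by
          rw [ENNReal.tsum_mul_left, ENNReal.mul_rpow_of_nonneg _ _ (by positivity),
            ← ENNReal.rpow_mul, mul_one_div_cancel hq0.ne', ENNReal.rpow_one]

section Amalgam

variable {P : Measure ℝ} [IsProbabilityMeasure P] {p : ℝ} {q : ℝ≥0∞} {f : ℕ → ℝ → ℝ}

lemma normHS_le (hp : 1 ≤ p) (hq : q ≠ 0) (hf : f ∈ dyadicMartingales P) :
    normHS P p q f ≤ ENNReal.ofReal (p * 4) * normHstar P p q f := by
  have hp0 : 0 < p := by linarith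
  refine amalgamNorm_le_mul hp0 hq fun j => ?_
  rw [← lintegral_quadVar_localize f hp0, ← lintegral_maximalFn_localize hf.2 hp0]
  exact lintegral_quadVar_rpow_le hp (martingale_localize hf.1 j) (bddMeas_localize hf.1 j)

lemma normHstar_le (hp : 1 ≤ p) (hq : q ≠ 0) (hf : f ∈ dyadicMartingales P) :
    normHstar P p q f ≤ ENNReal.ofReal (p * 40) * normHS P p q f := by
  have hp0 : 0 < p := by linarith
  refine amalgamNorm_le_mul hp0 hq fun j => ?_
  rw [← lintegral_quadVar_localize f hp0, ← lintegral_maximalFn_localize hf.2 hp0]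
  exact lintegral_maximalFn_rpow_le hp (martingale_localize hf.1 j) (bddMeas_localize hf.1 j)
    fun x => by simp [localize]

lemma hardyS_eq_hardyStar (hp : 1 ≤ p) (hq : q ≠ 0) : hardyS P p q = hardyStar P p q := by
  ext f
  refine and_congr_right fun hf => ⟨fun h => ?_, fun h => ?_⟩
  · exact (normHstar_le hp hq hf).trans_lt (ENNReal.mul_lt_top ENNReal.ofReal_lt_top h)
  · exact (normHS_le hp hq hf).trans_lt (ENNReal.mul_lt_top ENNReal.ofReal_lt_top h)

end Amalgam

end DyadicAmalgam

theorem theorem3p3 (p : ℝ) (hp : 1 ≤ p) :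
    ∃ c C : ℝ≥0, 0 < c ∧ 0 < C ∧
      ∀ (P : Measure ℝ) [IsProbabilityMeasure P] (q : ℝ≥0∞), 1 ≤ q →
        DyadicAmalgam.hardyS P p q = DyadicAmalgam.hardyStar P p q ∧
        ∀ f ∈ DyadicAmalgam.dyadicMartingales P,
          (c : ℝ≥0∞) * DyadicAmalgam.normHS P p q f ≤ DyadicAmalgam.normHstar P p q f ∧
          DyadicAmalgam.normHstar P p q f ≤ (C : ℝ≥0∞) * DyadicAmalgam.normHS P p q f := by
  have h4 : 0 < (p * 4).toNNReal := Real.toNNReal_pos.2 (by linarith)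
  refine ⟨(p * 4).toNNReal⁻¹, (p * 40).toNNReal, inv_pos.2 h4,
    Real.toNNReal_pos.2 (by linarith), fun P _ q hq => ?_⟩
  have hq0 : q ≠ 0 := (zero_lt_one.trans_le hq).ne'
  refine ⟨DyadicAmalgam.hardyS_eq_hardyStar hp hq0, fun f hf =>
    ⟨?_, DyadicAmalgam.normHstar_le hp hq0 hf⟩⟩
  calc _ ≤ (((p * 4).toNNReal⁻¹ : ℝ≥0) : ℝ≥0∞)
          * (ENNReal.ofReal (p * 4) * DyadicAmalgam.normHstar P p q f) := by
        gcongr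
        exact DyadicAmalgam.normHS_le hp hq0 hf
    _ = DyadicAmalgam.normHstar P p q f := by
        rw [← mul_assoc, ENNReal.ofReal, ← ENNReal.coe_mul, inv_mul_cancel₀ h4.ne',
          ENNReal.coe_one, one_mul]
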